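/- A tree is a partially ordered set $(T,\le)$ with a minimum such that for every $t\in T$ the set of strict predecessors of $t$ is finite and linearly ordered, every $t\in T$ has finitely many immediate successors, and all maximal chains have the same cardinality; it has infinite height if its maximal chains are infinite. The level of $t$ is the number of its strict predecessors, and $T(n)$ is the set of nodes of level $n$. A set $D\subseteq T$ is dense in $T$ if $\{n: D\cap T(n)\neq\emptyset\}$ is an infinite set $\{\ell_0<\ell_1<\dots\}$ and for all $k$ every $t\in T(k)$ satisfies $t\le s$ for some $s\in D\cap T(\ell_k)$. Let $d\geq 1$ and let $\mathbf T=(T_1,\dots,T_d)$ be a vector tree of infinite height, that is, a sequence of trees of infinite height. Let $\otimes\mathbf T=\bigcup_n T_1(n)\times\dots\times T_d(n)$ with the coordinatewise order. A vector subset of $\mathbf T$ is a tuple $\mathbf D=(D_1,\dots,D_d)$ with $D_i\subseteq T_i$ such that $\{n:D_i\cap T_i(n)\ne\emptyset\}$ does not depend on $i$; it is dense if each $D_i$ is dense in $T_i$; and $\otimes\mathbf D=\otimes\mathbf T\cap(D_1\times\dots\times D_d)$. Let $\mathcal U(\mathbf T)$ be the set of all $U\subseteq\otimes\mathbf T$ that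 have a minimum, with the topology of a subspace of $\{0,1\}^{\otimes\mathbf T}$. For a vector subset $\mathbf D$, a $\mathbf D$-subspace of $\mathcal U(\mathbf T)$ is a family $\mathbf U=(U_{\mathbf t})_{\mathbf t\in\otimes\mathbf D}$ of pairwise disjoint elements of $\mathcal U(\mathbf T)$ with $\min U_{\mathbf t}=\mathbf t$ for all $\mathbf t\in\otimes\mathbf D$; we write $\mathbf D(\mathbf U)=\mathbf D$, and a subspace is a $\mathbf D$-subspace for some vector subset $\mathbf D$. Its span is $[\mathbf U]=\{\bigcup_{\mathbf t\in\Gamma}U_{\mathbf t}:\Gamma\subseteq\otimes\mathbf D\}\cap\mathcal U(\mathbf T)$, and $\mathbf U'\le\mathbf U$ means $[\mathbf U']\subseteq[\mathbf U]$. A subset of a topological space is Souslin measurable if it belongs to the smallest algebra of subsets that contains the open sets and is closed under the Souslin operation $(X_s)_{s\in\omega^{<\omega}}\mapsto\bigcup_{\sigma\in\omega^\omega}\bigcap_{n}X_{\sigma\restriction n}$; a finite coloring is Souslin measurable if the inverse image of every color is. **Lemma.** Let $\mathbf T$ be a vector tree of infinite height, $r$ a positive integer and $c:\mathcal U(\mathbf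 T)\to\{1,\dots,r\}$ a Souslin measurable coloring. Let $\mathbf D$ be a dense vector subset of $\mathbf T$ and $\mathbf U$ a $\mathbf D$-subspace of $\mathcal U(\mathbf T)$. Then there exists a subspace $\mathbf U'$ of $\mathcal U(\mathbf T)$ with $\mathbf U'\le\mathbf U$ such that $\mathbf D(\mathbf U')$ is a dense vector subset of $\mathbf T$ and $c(U)=c(U')$ for all $U,U'\in[\mathbf U']$ with $\min U=\min U'$. -/

import Mathlib

universe u

namespace VectorTree

/-! ### Trees -/

/-- A tree: a partially ordered set with a minimum (the root `⊥`) in which the predecessors of every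
node form a finite chain (hence a finite well ordered set), every node has finitely many immediate
successors, and all maximal chains have the same cardinality. -/
structure IsTree (T : Type u) [PartialOrder T] [OrderBot T] : Prop where
  finite_pred : ∀ t : T, (Set.Iio t).Finite
  chain_pred : ∀ t : T, IsChain (· ≤ ·) (Set.Iio t)
  finite_imsuc : ∀ t : T, {s : T | t ⋖ s}.Finite
  balanced : ∀ C C' : Set T, IsMaxChain (· ≤ ·) C → IsMaxChain (· ≤ ·) C' →
    Cardinal.mk C = Cardinal.mk C'

/-- The tree has infinite height: its maximal chains are infinite. -/
def HasInfiniteHeight (T : Type u) [PartialOrder T] : Prop :=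
  ∀ C : Set T, IsMaxChain (· ≤ ·) C → C.Infinite

/-- The level `ℓ_T(t)`: the number of predecessors of `t`. -/
noncomputable def level {T : Type u} [PartialOrder T] (t : T) : ℕ := (Set.Iio t).ncard

/-- The level set `L_T(D)` of a subset `D` of `T`. -/
def levelSet {T : Type u} [PartialOrder T] (D : Set T) : Set ℕ := {n | ∃ t ∈ D, level t = n}

/-- `D` is dense in `T`: its level set is infinite, say `{ℓ₀ < ℓ₁ < ...}`, and for every `k` each
node of level `k` lies below some node of `D` of level `ℓₖ`. -/
def IsDenseSubset {T : Type u} [PartialOrder T] (D : Set T) : Prop :=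
  (levelSet D).Infinite ∧
    ∀ (k : ℕ) (t : T), level t = k → ∃ s ∈ D, level s = Nat.nth (· ∈ levelSet D) k ∧ t ≤ s

/-! ### Vector trees, level products and vector subsets -/

variable {d : ℕ}

/-- The level product `⊗T`: the tuples all of whose coordinates have the same level. As a subtype of
the product it carries the coordinatewise order. -/
abbrev LevelProduct (T : Fin d → Type u) [∀ i, PartialOrder (T i)] : Type u :=
  {t : (∀ i, T i) // ∃ n : ℕ, ∀ i, level (t i) = n}

/-- A vector subset: a tuple of subsets of the components with a common level set. -/
def IsVectorSubset {T : Fin d → Type u} [∀ i, PartialOrder (T i)] (D : ∀ i, Set (T i)) : Prop :=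
  ∀ i j, levelSet (D i) = levelSet (D j)

/-- A dense vector subset. -/
def IsDenseVectorSubset {T : Fin d → Type u} [∀ i, PartialOrder (T i)]
    (D : ∀ i, Set (T i)) : Prop :=
  IsVectorSubset D ∧ ∀ i, IsDenseSubset (D i)

/-- The level product `⊗D`, as a subset of `⊗T`. -/
def levelProd {T : Fin d → Type u} [∀ i, PartialOrder (T i)] (D : ∀ i, Set (T i)) :
    Set (LevelProduct T) :=
  {t | ∀ i, t.1 i ∈ D i}

/-! ### The space of subsets of the level product that have a minimum -/

/-- `𝒰(T)`: the subsets of `⊗T` that have a minimum. -/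
def 𝒰 (T : Fin d → Type u) [∀ i, PartialOrder (T i)] : Type u :=
  {U : Set (LevelProduct T) // ∃ m, IsLeast U m}

/-- The underlying subset of `⊗T`. -/
def 𝒰.carrier {T : Fin d → Type u} [∀ i, PartialOrder (T i)] (U : 𝒰 T) : Set (LevelProduct T) :=
  U.1

/-- The minimum of an element of `𝒰(T)`. -/
noncomputable def 𝒰.min {T : Fin d → Type u} [∀ i, PartialOrder (T i)] (U : 𝒰 T) :
    LevelProduct T :=
  U.2.choose

theorem 𝒰.isLeast_min {T : Fin d → Type u} [∀ i, PartialOrder (T i)] (U : 𝒰 T) :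
    IsLeast U.carrier U.min :=
  U.2.choose_spec

open Classical in
/-- The topology of `𝒰(T)` as a subspace of `{0,1}^{⊗T}`, each set being identified with its
indicator function and `{0,1}` being discrete. -/
noncomputable instance instTopologicalSpace𝒰 {T : Fin d → Type u} [∀ i, PartialOrder (T i)] :
    TopologicalSpace (𝒰 T) :=
  TopologicalSpace.induced (fun (U : 𝒰 T) (t : LevelProduct T) => decide (t ∈ U.carrier))
    (inferInstance : TopologicalSpace (LevelProduct T → Bool))

/-! ### Souslin measurability -/

/-- The members of the smallest algebra of subsets of `X` that contains the open sets and is closed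
under the Souslin operation. The list `(List.range n).map σ` is the restriction of `σ` to `n`. -/
inductive SouslinMeasurable {X : Type u} [TopologicalSpace X] : Set X → Prop
  | of_isOpen (A : Set X) : IsOpen A → SouslinMeasurable A
  | compl (A : Set X) : SouslinMeasurable A → SouslinMeasurable Aᶜ
  | union (A B : Set X) : SouslinMeasurable A → SouslinMeasurable B → SouslinMeasurable (A ∪ B)
  | souslin (A : List ℕ → Set X) : (∀ s, SouslinMeasurable (A s)) →
      SouslinMeasurable (⋃ σ : ℕ → ℕ, ⋂ n : ℕ, A ((List.range n).map σ))

/-- A coloring is Souslin measurable if the inverse image of every color is. -/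
def IsSouslinColoring {X : Type u} [TopologicalSpace X] {r : ℕ} (c : X → Fin r) : Prop :=
  ∀ i, SouslinMeasurable (c ⁻¹' {i})

/-! ### Subspaces -/

/-- A `D`-subspace of `𝒰(T)`: a family of pairwise disjoint elements of `𝒰(T)` indexed by `⊗D`
such that the minimum of the member of index `t` is `t`. -/
structure DSubspace {T : Fin d → Type u} [∀ i, PartialOrder (T i)] (D : ∀ i, Set (T i)) where
  set : levelProd D → 𝒰 T
  disjoint : ∀ s t, s ≠ t → Disjoint (set s).carrier (set t).carrier
  min_eq : ∀ t, (set t).min = t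

/-- The span `[U]`: the unions of subfamilies of `U` that belong to `𝒰(T)`. -/
def DSubspace.span {T : Fin d → Type u} [∀ i, PartialOrder (T i)] {D : ∀ i, Set (T i)}
    (U : DSubspace D) : Set (𝒰 T) :=
  {V | ∃ Γ : Set (levelProd D), V.carrier = ⋃ t ∈ Γ, (U.set t).carrier}

/-- `U'` is a further subspace of `U` if `[U'] ⊆ [U]`. -/
def DSubspace.IsFurther {T : Fin d → Type u} [∀ i, PartialOrder (T i)] {D' D : ∀ i, Set (T i)}
    (U' : DSubspace D') (U : DSubspace D) : Prop :=
  U'.span ⊆ U.span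

end VectorTree

open VectorTree

open VectorTree

/-! A set in the span of `U` with minimum t is U_t together with some members U_p, p > t, hence a
point of the Cantor space over {p > t}. The coloring pulls back there to one with the property of
Baire (`BaireMeasurableSet.souslin`, `continuous_unionAbove`). So there are open sets O_i with dense
union and dense open sets W_j such that every point of O_i lying in all W_j has color i
(`exists_isOpen_coloring`).

The new subspace comes from an infinite set L of levels and a partial map h sending nodes to owners
below them: nodes of level in L own themselves, and the new member at t is the union of the U_p
owned by t. `exists_fusion` builds L and h by finite stages. A stage adds a level to L and treats
the finitely many pairs t ∈ Γ up to that level, handing higher nodes to t or to nobody so that the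
point coded by Γ above t is forced into a prescribed open set. Below each stage bound an arbitrary Γ
looks like such a finite one, so it enters every W_j. When the level of t joins L, the point of {t}
is forced into some O_i by its values below the next bound. All later levels of L lie above that
bound, so every Γ with minimum t agrees with {t} there, and its color is i. -/

/-! ### The property of Baire and the Souslin operation. -/

open Topology Set Filter in
/-- Every set has a hull with the property of Baire, which is minimal up to meagre sets. -/
theorem exists_baireMeasurable_hull {X : Type*} [TopologicalSpace X] [SecondCountableTopology X]
    (E : Set X) : ∃ H : Set X, E ⊆ H ∧ BaireMeasurableSet H ∧
      ∀ C, BaireMeasurableSet C → E ⊆ C → IsMeagre (H \ C) := by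
  -- The hull removes from the space the points outside `E` of the basic open sets in which `E` is
  -- meagre.
  let S : Set (Set X) := {O | O ∈ TopologicalSpace.countableBasis X ∧ IsMeagre (O ∩ E)}
  have hS : S.Countable := (TopologicalSpace.countable_countableBasis X).mono fun O h => h.1
  have hSE : IsMeagre (⋃₀ S ∩ E) := by
    rw [sUnion_eq_biUnion, iUnion₂_inter]
    exact isMeagre_biUnion hS fun O hO => hO.2
  have hSo : IsOpen (⋃₀ S) :=
    isOpen_sUnion fun O hO => TopologicalSpace.isOpen_of_mem_countableBasis hO.1
  refine ⟨(⋃₀ S)ᶜ ∪ (⋃₀ S ∩ E), ?_, hSo.baireMeasurableSet.compl.union hSE.baireMeasurableSet, ?_⟩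
  · intro x hx
    by_cases h : x ∈ ⋃₀ S
    · exact Or.inr ⟨h, hx⟩
    · exact Or.inl h
  · intro C hC hEC
    obtain ⟨W, hWo, hW⟩ := hC.compl.residualEq_isOpen
    have hW' : {x | x ∈ Cᶜ ↔ x ∈ W} ∈ residual X := eventuallyEq_set.1 hW
    -- `W` is `Cᶜ` up to a meagre set and `C` covers `E`, so `E` is meagre in every basic open
    -- subset of `W`.
    have hWS : W ⊆ ⋃₀ S := by
      intro x hx
      obtain ⟨O, hO, hxO, hOW⟩ :=
        (TopologicalSpace.isBasis_countableBasis X).exists_subset_of_mem_open hx hWo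
      refine ⟨O, ⟨hO, ?_⟩, hxO⟩
      refine mem_of_superset hW' fun y hy hyE => ?_
      exact hy.2 (hOW hyE.1) (hEC hyE.2)
    refine mem_of_superset hW' fun y hy hyE => ?_
    rcases hyE.1 with h | h
    · exact h (hWS (hy.1 hyE.2))
    · exact hyE.2 (hEC h.2)

open Topology Set Filter in
/-- The property of Baire is preserved by the Souslin operation. -/
theorem BaireMeasurableSet.souslin {X : Type*} [TopologicalSpace X] [SecondCountableTopology X]
    {A : List ℕ → Set X} (hA : ∀ s, BaireMeasurableSet (A s)) :
    BaireMeasurableSet (⋃ σ : ℕ → ℕ, ⋂ n : ℕ, A ((List.range n).map σ)) := by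
  let R : List ℕ → Set X := fun s =>
    {x | ∃ σ : ℕ → ℕ, (List.range s.length).map σ = s ∧ ∀ n, x ∈ A ((List.range n).map σ)}
  have hR : (⋃ σ : ℕ → ℕ, ⋂ n : ℕ, A ((List.range n).map σ)) = R [] := by
    ext x
    simp [R]
  have hRA : ∀ s, R s ⊆ A s := by
    rintro s x ⟨σ, hσ, h⟩
    exact hσ ▸ h s.length
  have hRsucc : ∀ s, R s ⊆ ⋃ n, R (s ++ [n]) := by
    rintro s x ⟨σ, hσ, h⟩
    refine mem_iUnion.2 ⟨σ s.length, σ, ?_, h⟩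
    simp [List.range_succ, hσ]
  choose H hRH hHB hHmin using fun s => exists_baireMeasurable_hull (R s)
  let E : List ℕ → Set X := fun s => H s ∩ A s
  have hRE : ∀ s, R s ⊆ E s := fun s x hx => ⟨hRH s hx, hRA s hx⟩
  have hEB : ∀ s, BaireMeasurableSet (E s) := fun s => (hHB s).inter (hA s)
  -- By minimality of the hull of `R s`. Off this meagre set, a branch can be followed from any
  -- point of `E []`.
  have hM : IsMeagre (⋃ s, E s \ ⋃ n, E (s ++ [n])) := by
    refine isMeagre_iUnion fun s => ?_
    refine (hHmin s (⋃ n, E (s ++ [n])) (BaireMeasurableSet.iUnion fun n => hEB _)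
      ((hRsucc s).trans (iUnion_mono fun n => hRE _))).mono ?_
    exact sdiff_subset_sdiff_left inter_subset_left
  rw [hR]
  refine (hEB []).congr (eventuallyEq_set.2 ?_)
  refine mem_of_superset hM fun x hx => ⟨fun hxE => ?_, fun h => hRE _ h⟩
  have step : ∀ s : {s // x ∈ E s}, ∃ n, x ∈ E (s.1 ++ [n]) := by
    intro s
    by_contra! hcon
    exact hx (mem_iUnion.2 ⟨s.1, s.2, by simpa using hcon⟩)
  choose f hf using step
  let τ : ℕ → {s // x ∈ E s} := fun k => Nat.rec ⟨[], hxE⟩ (fun _ s => ⟨s.1 ++ [f s], hf s⟩) k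
  have hτ : ∀ k, (List.range k).map (fun i => f (τ i)) = (τ k).1 := by
    intro k
    induction k with
    | zero => rfl
    | succ k ih => rw [List.range_succ, List.map_append, ih]; rfl
  exact ⟨fun i => f (τ i), rfl, fun n => by rw [hτ]; exact (τ n).2.2⟩

/-- Continuous preimages of Souslin measurable sets have the property of Baire. -/
theorem VectorTree.SouslinMeasurable.baireMeasurableSet_preimage {X : Type*} {Y : Type u}
    [TopologicalSpace X] [SecondCountableTopology X] [TopologicalSpace Y] {f : X → Y}
    (hf : Continuous f) {A : Set Y} (hA : SouslinMeasurable A) : BaireMeasurableSet (f ⁻¹' A) := by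
  induction hA with
  | of_isOpen A hA => exact (hA.preimage hf).baireMeasurableSet
  | compl A _ ih => exact ih.compl
  | union A B _ _ ihA ihB => exact ihA.union ihB
  | souslin A _ ih =>
    have := BaireMeasurableSet.souslin ih
    simpa only [Set.preimage_iUnion, Set.preimage_iInter] using this

/-! ### Generic colors and forcing by finitely many coordinates. -/

open Topology Set Filter in
/-- A finite coloring whose color classes have the property of Baire is locally constant
on a comeagre set. -/
theorem exists_isOpen_coloring {X : Type*} [TopologicalSpace X] [BaireSpace X] {r : ℕ}
    {c : X → Fin r} (hc : ∀ i, BaireMeasurableSet (c ⁻¹' {i})) :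
    ∃ (O : Fin r → Set X) (W : ℕ → Set X), (∀ i, IsOpen (O i)) ∧ Dense (⋃ i, O i) ∧
      (∀ n, IsOpen (W n) ∧ Dense (W n)) ∧ ∀ x, (∀ n, x ∈ W n) → ∀ i, x ∈ O i → c x = i := by
  choose O hO hcO using fun i => (hc i).residualEq_isOpen
  have hres : {x | ∀ i, x ∈ c ⁻¹' {i} ↔ x ∈ O i} ∈ residual X :=
    eventually_all.2 fun i => eventuallyEq_set.1 (hcO i)
  obtain ⟨G, hG, hGδ, hGd⟩ := mem_residual.1 hres
  obtain ⟨W, hW, rfl⟩ := hGδ.eq_iInter_nat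
  refine ⟨O, W, hO, hGd.mono fun x hx => mem_iUnion.2 ⟨c x, (hG hx _).1 rfl⟩,
    fun n => ⟨hW n, hGd.mono (iInter_subset _ n)⟩, fun x hx i hi => ?_⟩
  exact (hG (mem_iInter.2 hx) i).2 hi

/-- In the Cantor space over a set with a finite-to-one rank function, a point may be changed
above any given rank to enter a member of a family of open sets with dense union, because of its
values below some rank. -/
theorem exists_agree_forcing {I : Type*} {ℓ : I → ℕ} (hfin : ∀ n, {p | ℓ p < n}.Finite)
    {𝒱 : Set (Set (I → Bool))} (ho : ∀ V ∈ 𝒱, IsOpen V) (hd : Dense (⋃₀ 𝒱)) (a : I → Bool)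
    (n : ℕ) :
    ∃ n' ≥ n, ∃ b : I → Bool, (∀ p, ℓ p < n → b p = a p) ∧
      ∃ V ∈ 𝒱, ∀ b' : I → Bool, (∀ p, ℓ p < n' → b' p = b p) → b' ∈ V := by
  have hopen : IsOpen (Set.pi {p | ℓ p < n} fun p => {a p}) :=
    isOpen_set_pi (hfin n) fun p _ => isOpen_discrete _
  obtain ⟨b, hb, V, hV, hbV⟩ := hd.inter_open_nonempty _ hopen ⟨a, fun p _ => rfl⟩
  obtain ⟨F, u, hu, hFV⟩ := isOpen_pi_iff.1 (ho V hV) b hbV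
  refine ⟨max n (F.sup ℓ + 1), le_max_left _ _, b, fun p hp => hb p hp, V, hV,
    fun b' hb' => hFV ?_⟩
  intro p hp
  rw [hb' p (lt_max_of_lt_right (Nat.lt_succ_of_le (Finset.le_sup hp)))]
  exact (hu p hp).2

/-! ### Levels and density in trees and level products. -/

namespace VectorTree

section Trees

theorem levelSet_sep {T : Type u} [PartialOrder T] {D : Set T} {L : Set ℕ} (hL : L ⊆ levelSet D) :
    levelSet {x ∈ D | level x ∈ L} = L := by
  ext n
  constructor
  · rintro ⟨t, ht, rfl⟩
    exact ht.2
  · intro hn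
    obtain ⟨t, ht, rfl⟩ := hL hn
    exact ⟨t, ⟨ht, hn⟩, rfl⟩

variable {T : Type u} [PartialOrder T] [OrderBot T]

theorem level_lt_level (hT : IsTree T) {x y : T} (h : x < y) : level x < level y :=
  Set.ncard_lt_ncard (Set.Iio_ssubset_Iio h) (hT.finite_pred y)

theorem level_of_covBy (hT : IsTree T) {x y : T} (h : x ⋖ y) : level y = level x + 1 := by
  have : Set.Iio y = insert x (Set.Iio x) := by
    ext z
    refine ⟨fun hz => ?_, ?_⟩
    · by_cases hzx : z = x
      · exact Or.inl hzx
      rcases hT.chain_pred y hz h.1 hzx with h1 | h1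
      · exact Or.inr (lt_of_le_of_ne h1 hzx)
      · exact (h.2 (lt_of_le_of_ne h1 (Ne.symm hzx)) hz).elim
    · rintro (rfl | hz)
      · exact h.1
      · exact lt_trans hz h.1
  rw [level, this, Set.ncard_insert_of_notMem (by simp) (hT.finite_pred x), level]

theorem exists_covBy_le (hT : IsTree T) {x y : T} (h : x < y) : ∃ z, x ⋖ z ∧ z ≤ y := by
  have hfin : (Set.Ioc x y).Finite := by
    refine ((hT.finite_pred y).insert y).subset fun z hz => ?_
    exact hz.2.eq_or_lt
  obtain ⟨z, hz, hmin⟩ := hfin.exists_minimal ⟨y, h, le_rfl⟩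
  refine ⟨z, ⟨hz.1, fun w hxw hwz => ?_⟩, hz.2⟩
  exact absurd (hmin ⟨hxw, hwz.le.trans hz.2⟩ hwz.le) hwz.not_ge

theorem exists_covBy_of_pos (hT : IsTree T) {y : T} (h : 0 < level y) : ∃ x, x ⋖ y := by
  obtain ⟨x, hx, hmax⟩ := (hT.finite_pred y).exists_maximal (Set.nonempty_of_ncard_ne_zero h.ne')
  exact ⟨x, hx, fun w hxw hwy => absurd (hmax hwy hxw.le) hxw.not_ge⟩

theorem finite_level (hT : IsTree T) (n : ℕ) : {t : T | level t = n}.Finite := by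
  induction n with
  | zero =>
    refine (Set.finite_singleton (⊥ : T)).subset fun t ht => ?_
    by_contra hne
    have := level_lt_level hT (bot_lt_iff_ne_bot.2 hne)
    simp_all
  | succ n ih =>
    refine (ih.biUnion fun t _ => hT.finite_imsuc t).subset fun y hy => ?_
    have hy : level y = n + 1 := hy
    obtain ⟨x, hx⟩ := exists_covBy_of_pos hT (y := y) (by omega)
    have := level_of_covBy hT hx
    exact Set.mem_biUnion (show level x = n by omega) hx

/-- A maximal node and its predecessors would form a finite maximal chain. -/
theorem exists_gt_of_infiniteHeight (hT : IsTree T) (hT' : HasInfiniteHeight T) (t : T) :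
    ∃ s, t < s := by
  by_contra! hmax
  have hchain : IsChain (· ≤ ·) (Set.Iic t) := by
    intro x hx y hy hne
    rcases (show x ≤ t from hx).eq_or_lt with rfl | hx'
    · exact Or.inr hy
    rcases (show y ≤ t from hy).eq_or_lt with rfl | hy'
    · exact Or.inl hx
    exact hT.chain_pred t hx' hy' hne
  have : IsMaxChain (· ≤ ·) (Set.Iic t) := by
    refine ⟨hchain, fun C hC hsub => hsub.antisymm fun y hy => ?_⟩
    rcases hC.total hy (hsub (Set.self_mem_Iic (a := t))) with h | h
    · exact h
    · exact (h.eq_or_lt.resolve_right (hmax y)).ge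
  refine hT' _ this (((hT.finite_pred t).insert t).subset fun z hz => ?_)
  exact (show z ≤ t from hz).eq_or_lt

theorem exists_le_level_eq (hT : IsTree T) (hT' : HasInfiniteHeight T) (t : T) {n : ℕ}
    (hn : level t ≤ n) : ∃ s, t ≤ s ∧ level s = n := by
  induction n, hn using Nat.le_induction with
  | base => exact ⟨t, le_rfl, rfl⟩
  | succ n _ ih =>
    obtain ⟨s, hts, hs⟩ := ih
    obtain ⟨y, hy⟩ := exists_gt_of_infiniteHeight hT hT' s
    obtain ⟨z, hz, -⟩ := exists_covBy_le hT hy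
    exact ⟨z, hts.trans hz.le, by rw [level_of_covBy hT hz, hs]⟩

open Classical in
/-- A dense subset of a tree of infinite height remains dense when it is restricted to infinitely
many of its levels. -/
theorem IsDenseSubset.sep (hT : IsTree T) (hT' : HasInfiniteHeight T) {D : Set T}
    (hD : IsDenseSubset D) {L : Set ℕ} (hL : L ⊆ levelSet D) (hLinf : L.Infinite) :
    IsDenseSubset {x ∈ D | level x ∈ L} := by
  rw [IsDenseSubset, levelSet_sep hL]
  refine ⟨hLinf, fun k t hk => ?_⟩
  set m := Nat.nth (· ∈ L) k
  have hm : m ∈ L := Nat.nth_mem_of_infinite (p := fun x => x ∈ L) hLinf k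
  -- The node `t` can thus be raised to the level equal to the index of `m` in `levelSet D`, where
  -- density of `D` yields a node of level `m`.
  have hcount : k ≤ Nat.count (· ∈ levelSet D) m := by
    calc k = Nat.count (fun x => x ∈ L) m := (Nat.count_nth_of_infinite (p := fun x => x ∈ L) hLinf k).symm
      _ ≤ _ := Nat.count_mono_left fun j _ (hj : j ∈ L) => hL hj
  obtain ⟨y, hty, hy⟩ := exists_le_level_eq hT hT' t (hk.trans_le hcount)
  obtain ⟨s, hsD, hs, hys⟩ := hD.2 _ y hy
  rw [Nat.nth_count (hL hm)] at hs
  exact ⟨s, ⟨hsD, hs ▸ hm⟩, hs, hty.trans hys⟩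

end Trees

section Products

variable {d : ℕ} {T : Fin d → Type u} [∀ i, PartialOrder (T i)]

theorem level_coord_eq (t : LevelProduct T) (i j : Fin d) : level (t.1 i) = level (t.1 j) := by
  obtain ⟨n, hn⟩ := t.2
  rw [hn i, hn j]

theorem strictMono_level_coord [∀ i, OrderBot (T i)] (hT : ∀ i, IsTree (T i)) (i : Fin d) :
    StrictMono fun t : LevelProduct T => level (t.1 i) := by
  intro s t hst
  have hst' : s.1 < t.1 := hst
  obtain ⟨hle, j, hj⟩ := Pi.lt_def.1 hst'
  show level (s.1 i) < level (t.1 i)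
  rw [level_coord_eq s i j, level_coord_eq t i j]
  exact level_lt_level (hT j) hj

theorem finite_level_coord_lt [∀ i, OrderBot (T i)] (hT : ∀ i, IsTree (T i)) (i : Fin d) (n : ℕ) :
    {t : LevelProduct T | level (t.1 i) < n}.Finite := by
  have hfin : (Set.univ.pi fun j => {x : T j | level x < n}).Finite := by
    refine Set.Finite.pi fun j => ?_
    have : {x : T j | level x < n} = ⋃ m ∈ Set.Iio n, {x : T j | level x = m} := by
      ext x
      simp
    rw [this]
    exact (Set.finite_Iio n).biUnion fun m _ => finite_level (hT j) m
  refine (hfin.preimage Subtype.val_injective.injOn).subset fun t ht j _ => ?_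
  show level (t.1 j) < n
  rw [level_coord_eq t j i]
  exact ht

end Products

end VectorTree

/-! ### Fusion of ownership maps. -/

/-- The set of points that a partial assignment sends into `Γ`. -/
def ownedBy {P : Type*} (h : P → Option P) (Γ : Set P) : Set P := {p | ∃ s ∈ Γ, h p = some s}

/-- The extension step for finitely many tasks. -/
theorem exists_extension_of_finite {P : Type*} [PartialOrder P] {ℓ : P → ℕ}
    {Q : P → ℕ → Set P → ℕ → Prop}
    (hQ : ∀ t j (a b : Set P) n n', n ≤ n' → (∀ p, t < p → ℓ p < n → (p ∈ a ↔ p ∈ b)) →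
      Q t j a n → Q t j b n')
    (hext : ∀ t j (a : Set P) n, ∃ n' ≥ n, ∃ b : Set P, (∀ p, t < p → ℓ p < n → (p ∈ a ↔ p ∈ b)) ∧
      Q t j b n')
    {F : Set (P × Set P × ℕ)} (hF : F.Finite) (hmem : ∀ x ∈ F, x.1 ∈ x.2.1)
    (n : ℕ) (h : P → Option P) (hh : ∀ p s, h p = some s → s ≤ p) :
    ∃ n' ≥ n, ∃ h' : P → Option P, (∀ p s, h' p = some s → s ≤ p) ∧
      (∀ p, ℓ p < n → h' p = h p) ∧ ∀ x ∈ F, Q x.1 x.2.2 (ownedBy h' x.2.1) n' := by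
  classical
  induction F, hF using Set.Finite.induction_on with
  | empty => exact ⟨n, le_rfl, h, hh, fun _ _ => rfl, by simp⟩
  | @insert x F _ _ ih =>
    obtain ⟨n₁, hn₁, h₁, hh₁, hagree, hF₁⟩ := ih fun y hy => hmem y (Or.inr hy)
    obtain ⟨t, Γ, j⟩ := x
    have htΓ : t ∈ Γ := hmem _ (Or.inl rfl)
    obtain ⟨n₂, hn₂, b, hb, hQb⟩ := hext t j (ownedBy h₁ Γ) n₁
    -- As `t ∈ Γ`, giving `t` the nodes of `b` makes the set owned by `Γ` agree with `b` above `t`.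
    -- Tasks already fulfilled depend only on ranks below `n₁`, where nothing changes.
    let h₂ : P → Option P := fun p =>
      if ℓ p < n₁ then h₁ p else if t < p ∧ p ∈ b then some t else none
    have hh₂ : ∀ p, ℓ p < n₁ → h₂ p = h₁ p := fun p hp => if_pos hp
    refine ⟨n₂, hn₁.trans hn₂, h₂, fun p s hps => ?_, fun p hp => ?_, ?_⟩
    · by_cases hp : ℓ p < n₁
      · exact hh₁ p s (hh₂ p hp ▸ hps)
      · simp only [h₂, if_neg hp] at hps
        split_ifs at hps with hpb
        exact Option.some.inj hps ▸ hpb.1.le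
    · rw [hh₂ p (hp.trans_le hn₁), hagree p hp]
    · have hsame : ∀ (Δ : Set P) p, ℓ p < n₁ → (p ∈ ownedBy h₁ Δ ↔ p ∈ ownedBy h₂ Δ) := by
        intro Δ p hp
        simp only [ownedBy, Set.mem_ofPred_eq, hh₂ p hp]
      rintro y (rfl | hy)
      · refine hQ t j b _ n₂ n₂ le_rfl (fun p htp _ => ?_) hQb
        by_cases hp : ℓ p < n₁
        · rw [← hb p htp hp, hsame Γ p hp]
        · simp only [ownedBy, Set.mem_ofPred_eq, h₂, if_neg hp]
          by_cases hpb : p ∈ b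
          · simp [htp, hpb, htΓ]
          · simp [hpb]
      · exact hQ _ _ _ _ _ _ hn₂ (fun p _ hp => hsame _ p hp) (hF₁ y hy)

/-- One stage of the fusion: a new level is made self-owned, and the tasks of all sets of nodes
up to that level are fulfilled. -/
theorem exists_fusion_step {P : Type*} [PartialOrder P] {ℓ : P → ℕ}
    (hfin : ∀ n, {p | ℓ p < n}.Finite) {M : Set ℕ} (hM : M.Infinite)
    {Q : P → ℕ → Set P → ℕ → Prop}
    (hQ : ∀ t j (a b : Set P) n n', n ≤ n' → (∀ p, t < p → ℓ p < n → (p ∈ a ↔ p ∈ b)) →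
      Q t j a n → Q t j b n')
    (hext : ∀ t j (a : Set P) n, ∃ n' ≥ n, ∃ b : Set P, (∀ p, t < p → ℓ p < n → (p ∈ a ↔ p ∈ b)) ∧
      Q t j b n')
    (k n : ℕ) (h : P → Option P) (hh : ∀ p s, h p = some s → s ≤ p) :
    ∃ (n' : ℕ) (h' : P → Option P), (∀ p s, h' p = some s → s ≤ p) ∧ ∃ m ∈ M, n ≤ m ∧ m < n' ∧
      (∀ p, ℓ p < n → h' p = h p) ∧ (∀ p, ℓ p = m → h' p = some p) ∧
      ∀ j ≤ k, ∀ Γ : Set P, (∀ s ∈ Γ, ℓ s ≤ m) → ∀ t ∈ Γ, Q t j (ownedBy h' Γ) n' := by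
  classical
  obtain ⟨m, hmM, hnm⟩ := hM.exists_gt n
  let h₁ : P → Option P := fun p => if ℓ p = m then some p else h p
  have hh₁ : ∀ p s, h₁ p = some s → s ≤ p := by
    intro p s hps
    by_cases hp : ℓ p = m
    · simp only [h₁, if_pos hp] at hps
      exact (Option.some.inj hps).ge
    · simp only [h₁, if_neg hp] at hps
      exact hh p s hps
  let F : Set (P × Set P × ℕ) := {x | x.2.2 ≤ k ∧ (∀ s ∈ x.2.1, ℓ s ≤ m) ∧ x.1 ∈ x.2.1}
  have hF : F.Finite := by
    refine ((hfin (m + 1)).prod ((hfin (m + 1)).finite_subsets.prod (Set.finite_Iic k))).subset ?_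
    rintro ⟨t, Γ, j⟩ ⟨hj, hΓ, ht⟩
    exact ⟨Nat.lt_succ_of_le (hΓ t ht), fun s hs => Nat.lt_succ_of_le (hΓ s hs), hj⟩
  -- The bound `m + 1` protects the self-owned level `m`.
  obtain ⟨n', hn', h', hh', hagree, hQ'⟩ :=
    exists_extension_of_finite hQ hext hF (fun x hx => hx.2.2) (m + 1) h₁ hh₁
  refine ⟨n', h', hh', m, hmM, hnm.le, hn', fun p hp => ?_, fun p hp => ?_,
    fun j hj Γ hΓ t ht => hQ' (t, Γ, j) ⟨hj, hΓ, ht⟩⟩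
  · rw [hagree p (by omega)]
    exact if_neg (by omega)
  · rw [hagree p (by omega)]
    exact if_pos hp

/-- The fusion lemma. -/
theorem exists_fusion {P : Type*} [PartialOrder P] {ℓ : P → ℕ} (hℓ : StrictMono ℓ)
    (hfin : ∀ n, {p | ℓ p < n}.Finite) {M : Set ℕ} (hM : M.Infinite)
    {Q : P → ℕ → Set P → ℕ → Prop}
    (hQ : ∀ t j (a b : Set P) n n', n ≤ n' → (∀ p, t < p → ℓ p < n → (p ∈ a ↔ p ∈ b)) →
      Q t j a n → Q t j b n')
    (hext : ∀ t j (a : Set P) n, ∃ n' ≥ n, ∃ b : Set P, (∀ p, t < p → ℓ p < n → (p ∈ a ↔ p ∈ b)) ∧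
      Q t j b n') :
    ∃ L ⊆ M, L.Infinite ∧ ∃ h : P → Option P, (∀ p s, h p = some s → s ≤ p) ∧
      (∀ p, ℓ p ∈ L → h p = some p) ∧ ∀ t, ℓ t ∈ L →
        (∀ j (Γ : Set P), (∀ s ∈ Γ, ℓ s ∈ L) → t ∈ Γ → ∃ n, Q t j (ownedBy h Γ) n) ∧
        ∃ n, Q t 0 (ownedBy h {t}) n ∧
          ∀ Γ : Set P, (∀ s ∈ Γ, ℓ s ∈ L ∧ t ≤ s) → t ∈ Γ →
            ∀ p, ℓ p < n → (p ∈ ownedBy h {t} ↔ p ∈ ownedBy h Γ) := by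
  have step : ∀ (k : ℕ) (S : {S : ℕ × (P → Option P) // ∀ p s, S.2 p = some s → s ≤ p}),
      ∃ S' : {S : ℕ × (P → Option P) // ∀ p s, S.2 p = some s → s ≤ p}, ∃ m ∈ M, S.1.1 ≤ m ∧
        m < S'.1.1 ∧ (∀ p, ℓ p < S.1.1 → S'.1.2 p = S.1.2 p) ∧
        (∀ p, ℓ p = m → S'.1.2 p = some p) ∧ ∀ j ≤ k, ∀ Γ : Set P, (∀ s ∈ Γ, ℓ s ≤ m) →
          ∀ t ∈ Γ, Q t j (ownedBy S'.1.2 Γ) S'.1.1 := by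
    intro k S
    obtain ⟨n', h', hh', H⟩ := exists_fusion_step hfin hM hQ hext k S.1.1 S.1.2 S.2
    exact ⟨⟨(n', h'), hh'⟩, H⟩
  choose G μ hμM hμ₁ hμ₂ hagree hself hforce using step
  let S : ℕ → {S : ℕ × (P → Option P) // ∀ p s, S.2 p = some s → s ≤ p} := fun k =>
    Nat.rec ⟨(0, fun _ => none), by simp⟩ G k
  let m : ℕ → ℕ := fun k => μ k (S k)
  have hm₁ : ∀ k, (S k).1.1 ≤ m k := fun k => hμ₁ k (S k)
  have hm₂ : ∀ k, m k < (S (k + 1)).1.1 := fun k => hμ₂ k (S k)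
  have hm : StrictMono m := strictMono_nat_of_lt_succ fun k => (hm₂ k).trans_le (hm₁ (k + 1))
  have hS : StrictMono fun k => (S k).1.1 :=
    strictMono_nat_of_lt_succ fun k => (hm₁ k).trans_lt (hm₂ k)
  have hstable : ∀ k k', k ≤ k' → ∀ p, ℓ p < (S k).1.1 → (S k').1.2 p = (S k).1.2 p := by
    intro k k' hkk' p hp
    induction k', hkk' using Nat.le_induction with
    | base => rfl
    | succ k' hk' ih =>
      exact (hagree k' (S k') p (hp.trans_le (hS.monotone hk'))).trans ih
  -- Stage bounds increase strictly, so by stage `ℓ p + 1` the value at `p` is final.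
  let h : P → Option P := fun p => (S (ℓ p + 1)).1.2 p
  have hh : ∀ k p, ℓ p < (S k).1.1 → h p = (S k).1.2 p := by
    intro k p hp
    have hp' : ℓ p < (S (ℓ p + 1)).1.1 := hS.le_apply (x := ℓ p + 1)
    rcases le_total k (ℓ p + 1) with hk | hk
    · exact hstable _ _ hk p hp
    · exact (hstable _ _ hk p hp').symm
  have hle : ∀ p s, h p = some s → s ≤ p := fun p s => (S (ℓ p + 1)).2 p s
  -- Owners lie below what they own, and the selected level after `m k` is at least the bound of
  -- stage `k + 1`.
  have howned : ∀ k (Γ : Set P), (∀ s ∈ Γ, ℓ s ∈ Set.range m) → ∀ p, ℓ p < (S (k + 1)).1.1 →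
      (p ∈ ownedBy h Γ ↔ p ∈ ownedBy (S (k + 1)).1.2 {s ∈ Γ | ℓ s ≤ m k}) := by
    intro k Γ hΓ p hp
    simp only [ownedBy, Set.mem_ofPred_eq, ← hh (k + 1) p hp]
    refine ⟨fun ⟨s, hs, hps⟩ => ⟨s, ⟨hs, ?_⟩, hps⟩, fun ⟨s, hs, hps⟩ => ⟨s, hs.1, hps⟩⟩
    obtain ⟨k', hk'⟩ := hΓ s hs
    have h1 : ℓ s ≤ ℓ p := hℓ.monotone (hle p s hps)
    have h2 : m k' < m (k + 1) := by
      rw [hk']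
      exact (h1.trans_lt hp).trans_le (hm₁ (k + 1))
    rw [← hk']
    exact hm.monotone (Nat.le_of_lt_succ (hm.lt_iff_lt.1 h2))
  refine ⟨Set.range m, ?_, Set.infinite_range_of_injective hm.injective, h, hle, ?_, ?_⟩
  · rintro _ ⟨k, rfl⟩
    exact hμM k (S k)
  · rintro p ⟨k, hk⟩
    rw [hh (k + 1) p (hk ▸ hm₂ k)]
    exact hself k (S k) p hk.symm
  · rintro t ⟨k, hk⟩
    refine ⟨fun j Γ hΓ ht => ?_, (S (k + 1)).1.1, ?_, fun Γ hΓ ht p hp => ?_⟩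
    -- A stage late enough both to treat task `j` and to have selected the level of `t`.
    · refine ⟨(S (max j k + 1)).1.1, ?_⟩
      refine hQ t j (ownedBy (S (max j k + 1)).1.2 {s ∈ Γ | ℓ s ≤ m (max j k)}) _ _ _ le_rfl
        (fun p _ hp => (howned _ Γ hΓ p hp).symm) ?_
      refine hforce _ _ j (le_max_left _ _) _ (fun s hs => hs.2) t ⟨ht, ?_⟩
      exact hk ▸ hm.monotone (le_max_right _ _)
    · refine hQ t 0 (ownedBy (S (k + 1)).1.2 {t}) _ _ _ le_rfl (fun p _ hp => ?_)
        (hforce k (S k) 0 (Nat.zero_le _) {t} (by rintro s rfl; exact hk.ge) t rfl)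
      simp only [ownedBy, Set.mem_ofPred_eq, hh (k + 1) p hp]
    · rw [howned k Γ (fun s hs => (hΓ s hs).1) p hp,
        howned k {t} (by rintro s rfl; exact ⟨k, hk⟩) p hp]
      have : {s ∈ Γ | ℓ s ≤ m k} = {s ∈ ({t} : Set P) | ℓ s ≤ m k} := by
        ext s
        constructor
        · rintro ⟨hs, hsk⟩
          refine ⟨?_, hsk⟩
          by_contra hne
          have := hℓ (lt_of_le_of_ne (hΓ s hs).2 (Ne.symm hne))
          omega
        · rintro ⟨rfl, hsk⟩
          exact ⟨ht, hsk⟩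
      rw [this]

/-! ### Coding unions by points of a Cantor space, and merging members of a subspace. -/

namespace VectorTree

variable {d : ℕ} {T : Fin d → Type u} [∀ i, PartialOrder (T i)]

theorem 𝒰.min_eq_of_isLeast {V : 𝒰 T} {m : LevelProduct T} (h : IsLeast V.carrier m) :
    V.min = m :=
  V.isLeast_min.unique h

theorem 𝒰.ext_carrier {V V' : 𝒰 T} (h : V.carrier = V'.carrier) : V = V' :=
  Subtype.ext h

namespace DSubspace

variable {D : ∀ i, Set (T i)}

theorem isLeast (U : DSubspace D) (t : levelProd D) : IsLeast (U.set t).carrier t.1 :=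
  U.min_eq t ▸ (U.set t).isLeast_min

/-- The union of `U t` and of those members of index above `t` that are selected by `x`. -/
def unionAbove (U : DSubspace D) (t : levelProd D) (x : {p // t < p} → Bool) : 𝒰 T :=
  ⟨{q | q ∈ (U.set t).carrier ∨ ∃ p, x p = true ∧ q ∈ (U.set p.1).carrier}, t.1,
    Or.inl (U.isLeast t).1, fun q hq => by
      rcases hq with hq | ⟨p, -, hq⟩
      · exact (U.isLeast t).2 hq
      · exact le_trans p.2.le ((U.isLeast p.1).2 hq)⟩

theorem mem_unionAbove {U : DSubspace D} {t : levelProd D} {x : {p // t < p} → Bool}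
    {q : LevelProduct T} : q ∈ (U.unionAbove t x).carrier ↔
      q ∈ (U.set t).carrier ∨ ∃ p, x p = true ∧ q ∈ (U.set p.1).carrier :=
  Iff.rfl

theorem eq_of_mem_of_mem (U : DSubspace D) {s t : levelProd D} {q : LevelProduct T}
    (hs : q ∈ (U.set s).carrier) (ht : q ∈ (U.set t).carrier) : s = t := by
  by_contra hne
  exact Set.disjoint_left.1 (U.disjoint s t hne) hs ht

/-- By disjointness of the members, whether a given `q` belongs to the union depends on at most one
coordinate. -/
theorem continuous_unionAbove (U : DSubspace D) (t : levelProd D) :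
    Continuous (U.unionAbove t) := by
  classical
  refine continuous_induced_rng.2 (continuous_pi fun q => ?_)
  by_cases hqt : q ∈ (U.set t).carrier
  · refine (continuous_const (y := true)).congr fun x => ?_
    simp [mem_unionAbove, hqt]
  by_cases hq : ∃ p : {p // t < p}, q ∈ (U.set p.1).carrier
  · obtain ⟨p, hp⟩ := hq
    refine (continuous_apply p).congr fun x => ?_
    have : q ∈ (U.unionAbove t x).carrier ↔ x p = true := by
      rw [mem_unionAbove]
      constructor
      · rintro (h | ⟨p', hx, hp'⟩)
        · exact (hqt h).elim
        · rwa [Subtype.ext (U.eq_of_mem_of_mem hp hp')]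
      · exact fun hx => Or.inr ⟨p, hx, hp⟩
    simp [this]
  · refine (continuous_const (y := false)).congr fun x => ?_
    have : q ∉ (U.unionAbove t x).carrier := by
      rintro (h | ⟨p, -, hp⟩)
      · exact hqt h
      · exact hq ⟨p, hp⟩
    simp [this]

/-- The indicator function of the part of a set of indices above `t`. -/
noncomputable def indicatorAbove (t : levelProd D) (A : Set (levelProd D)) : {p // t < p} → Bool :=
  open Classical in fun p => decide (p.1 ∈ A)

/-- The subspace whose member of index `t` is the union of the members owned by `t`. -/
def merge (U : DSubspace D) {D' : ∀ i, Set (T i)} (hD : levelProd D' ⊆ levelProd D)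
    (h : levelProd D → Option (levelProd D)) (hle : ∀ p s, h p = some s → s ≤ p)
    (hself : ∀ p : levelProd D, p.1 ∈ levelProd D' → h p = some p) : DSubspace D' :=
  have hleast : ∀ t : levelProd D', IsLeast
      {q | ∃ p, h p = some ⟨t.1, hD t.2⟩ ∧ q ∈ (U.set p).carrier} t.1 := fun t =>
    ⟨⟨⟨t.1, hD t.2⟩, hself _ t.2, (U.isLeast _).1⟩, by
      rintro q ⟨p, hp, hq⟩
      exact le_trans (hle p _ hp) ((U.isLeast p).2 hq)⟩
  { set := fun t => ⟨{q | ∃ p, h p = some ⟨t.1, hD t.2⟩ ∧ q ∈ (U.set p).carrier}, t.1, hleast t⟩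
    disjoint := fun s t hst => Set.disjoint_left.2 fun q hs ht => by
      obtain ⟨p, hp, hq⟩ := hs
      obtain ⟨p', hp', hq'⟩ := ht
      obtain rfl := U.eq_of_mem_of_mem hq hq'
      rw [hp] at hp'
      have := congrArg Subtype.val (Option.some.inj hp')
      exact hst (Subtype.ext this)
    min_eq := fun t => 𝒰.min_eq_of_isLeast (hleast t) }

section Merge

variable {U : DSubspace D} {D' : ∀ i, Set (T i)} {hD : levelProd D' ⊆ levelProd D}
  {h : levelProd D → Option (levelProd D)} {hle : ∀ p s, h p = some s → s ≤ p}
  {hself : ∀ p : levelProd D, p.1 ∈ levelProd D' → h p = some p}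

theorem mem_merge_set {t : levelProd D'} {q : LevelProduct T} :
    q ∈ ((U.merge hD h hle hself).set t).carrier ↔
      ∃ p, h p = some ⟨t.1, hD t.2⟩ ∧ q ∈ (U.set p).carrier :=
  Iff.rfl

/-- The members of the span of a merged subspace are unions over owned sets. -/
theorem exists_of_mem_span_merge {V : 𝒰 T} (hV : V ∈ (U.merge hD h hle hself).span) :
    ∃ Γ : Set (levelProd D), (∀ s ∈ Γ, s.1 ∈ levelProd D') ∧
      V.carrier = ⋃ p ∈ ownedBy h Γ, (U.set p).carrier := by
  obtain ⟨Γ, hΓ⟩ := hV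
  refine ⟨{s | ∃ t ∈ Γ, s.1 = t.1}, ?_, ?_⟩
  · rintro s ⟨t, -, hst⟩
    exact hst ▸ t.2
  · rw [hΓ]
    ext q
    simp only [Set.mem_iUnion, mem_merge_set, ownedBy, Set.mem_ofPred_eq, exists_prop]
    constructor
    · rintro ⟨t, ht, p, hp, hq⟩
      exact ⟨p, ⟨_, ⟨t, ht, rfl⟩, hp⟩, hq⟩
    · rintro ⟨p, ⟨s, ⟨t, ht, hst⟩, hp⟩, hq⟩
      refine ⟨t, ht, p, ?_, hq⟩
      rw [hp]
      exact congrArg some (Subtype.ext hst)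

theorem isFurther_merge : (U.merge hD h hle hself).IsFurther U := by
  intro V hV
  obtain ⟨Γ, -, hΓ⟩ := exists_of_mem_span_merge hV
  exact ⟨_, hΓ⟩

/-- The members of the span of a merged subspace in terms of their minimum. -/
theorem exists_eq_unionAbove_of_mem_span_merge {V : 𝒰 T}
    (hV : V ∈ (U.merge hD h hle hself).span) :
    ∃ t : levelProd D, t.1 = V.min ∧ t.1 ∈ levelProd D' ∧
      ∃ Γ : Set (levelProd D), (∀ s ∈ Γ, s.1 ∈ levelProd D' ∧ t ≤ s) ∧ t ∈ Γ ∧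
        V = U.unionAbove t (indicatorAbove t (ownedBy h Γ)) := by
  obtain ⟨Γ, hΓ, hVΓ⟩ := exists_of_mem_span_merge hV
  have hmem : ∀ q, q ∈ V.carrier ↔ ∃ p ∈ ownedBy h Γ, q ∈ (U.set p).carrier := by
    intro q
    rw [hVΓ]
    simp
  have hsub : ∀ s ∈ Γ, s.1 ∈ V.carrier := fun s hs =>
    (hmem _).2 ⟨s, ⟨s, hs, hself s (hΓ s hs)⟩, (U.isLeast s).1⟩
  -- The owner `t` of the index `p` whose member contains the minimum is the minimum: t ≤ p ≤ min
  -- `V`, and `t` itself lies in `V`.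
  obtain ⟨p, ⟨t, ht, hp⟩, hq⟩ := (hmem _).1 V.isLeast_min.1
  have htmin : t.1 = V.min :=
    le_antisymm (le_trans (hle p t hp) ((U.isLeast p).2 hq)) (V.isLeast_min.2 (hsub t ht))
  have htle : ∀ s ∈ Γ, t ≤ s := fun s hs =>
    show t.1 ≤ s.1 from htmin ▸ V.isLeast_min.2 (hsub s hs)
  have hown : ∀ p ∈ ownedBy h Γ, t ≤ p := by
    rintro p ⟨s, hs, hps⟩
    exact (htle s hs).trans (hle p s hps)
  refine ⟨t, htmin, hΓ t ht, Γ, fun s hs => ⟨hΓ s hs, htle s hs⟩, ht,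
    𝒰.ext_carrier (Set.ext fun q => ?_)⟩
  rw [hmem, mem_unionAbove]
  constructor
  · rintro ⟨p, hp, hq⟩
    rcases (hown p hp).eq_or_lt with rfl | hlt
    · exact Or.inl hq
    · exact Or.inr ⟨⟨p, hlt⟩, by simpa [indicatorAbove] using hp, hq⟩
  · rintro (hq | ⟨p, hp, hq⟩)
    · exact ⟨t, ⟨t, ht, hself t (hΓ t ht)⟩, hq⟩
    · exact ⟨p.1, by simpa [indicatorAbove] using hp, hq⟩

end Merge

end DSubspace

end VectorTree

/-! ### The theorem. -/

theorem mainTheorem6 {d : ℕ} (hd : 0 < d) (T : Fin d → Type u) [∀ i, PartialOrder (T i)]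
    [∀ i, OrderBot (T i)] (hT : ∀ i, IsTree (T i)) (hT' : ∀ i, HasInfiniteHeight (T i))
    {r : ℕ} (hr : 0 < r) (c : 𝒰 T → Fin r) (hc : IsSouslinColoring c)
    (D : ∀ i, Set (T i)) (hD : IsDenseVectorSubset D) (U : DSubspace D) :
    ∃ (D' : ∀ i, Set (T i)) (U' : DSubspace D'),
      U'.IsFurther U ∧ IsDenseVectorSubset D' ∧
        ∀ V ∈ U'.span, ∀ V' ∈ U'.span, V.min = V'.min → c V = c V' := by
  classical
  let i₀ : Fin d := ⟨0, hd⟩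
  let ℓ : levelProd D → ℕ := fun p => level (p.1.1 i₀)
  have hℓ : StrictMono ℓ := fun s t hst => strictMono_level_coord hT i₀ hst
  have hfin : ∀ n, {p | ℓ p < n}.Finite := fun n =>
    (finite_level_coord_lt hT i₀ n).preimage Subtype.val_injective.injOn
  have hcount : Countable (levelProd D) := by
    refine Set.countable_univ_iff.1 ?_
    refine (Set.countable_iUnion fun n => (hfin n).countable).mono fun p _ => ?_
    exact Set.mem_iUnion.2 ⟨ℓ p + 1, Nat.lt_succ_self _⟩
  have hfin' : ∀ (t : levelProd D) n, {p : {p // t < p} | ℓ p.1 < n}.Finite := fun t n =>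
    (hfin n).preimage Subtype.val_injective.injOn
  choose O W hO hOd hW hOW using fun t : levelProd D =>
    exists_isOpen_coloring (c := fun x => c (U.unionAbove t x)) fun i =>
      (hc i).baireMeasurableSet_preimage (U.continuous_unionAbove t)
  -- Task 0 chooses a color by entering some `O t i`; task `j + 1` enters `W t j`.
  let 𝒱 : ∀ t : levelProd D, ℕ → Set (Set ({p // t < p} → Bool)) := fun t j =>
    Nat.casesOn j (Set.range (O t)) fun j => {W t j}
  let Q : levelProd D → ℕ → Set (levelProd D) → ℕ → Prop := fun t j a n =>
    ∃ V ∈ 𝒱 t j, ∀ b, (∀ p, ℓ p.1 < n → b p = DSubspace.indicatorAbove t a p) → b ∈ V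
  obtain ⟨L, hLM, hL, h, hle, hself, hQ⟩ :
      ∃ L ⊆ levelSet (D i₀), L.Infinite ∧ ∃ h : levelProd D → Option (levelProd D),
        (∀ p s, h p = some s → s ≤ p) ∧ (∀ p, ℓ p ∈ L → h p = some p) ∧ ∀ t, ℓ t ∈ L →
          (∀ j (Γ : Set (levelProd D)), (∀ s ∈ Γ, ℓ s ∈ L) → t ∈ Γ →
            ∃ n, Q t j (ownedBy h Γ) n) ∧
          ∃ n, Q t 0 (ownedBy h {t}) n ∧ ∀ Γ : Set (levelProd D),
            (∀ s ∈ Γ, ℓ s ∈ L ∧ t ≤ s) → t ∈ Γ →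
              ∀ p, ℓ p < n → (p ∈ ownedBy h {t} ↔ p ∈ ownedBy h Γ) := by
    refine exists_fusion hℓ hfin (hD.2 i₀).1 ?_ ?_
    · rintro t j a b n n' hn hab ⟨V, hV, hforce⟩
      refine ⟨V, hV, fun b' hb' => hforce b' fun p hp => ?_⟩
      rw [hb' p (hp.trans_le hn)]
      simp only [DSubspace.indicatorAbove, hab p.1 p.2 hp]
    · intro t j a n
      obtain ⟨n', hn', b, hb, V, hV, hforce⟩ := exists_agree_forcing (hfin' t) (𝒱 := 𝒱 t j)
        (by
          cases j with
          | zero => rintro _ ⟨i, rfl⟩; exact hO t i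
          | succ j => rintro _ rfl; exact (hW t j).1)
        (by
          cases j with
          | zero => exact hOd t
          | succ j => simpa [𝒱] using (hW t j).2)
        (DSubspace.indicatorAbove t a) n
      have hind : DSubspace.indicatorAbove t {p | ∃ hp : t < p, b ⟨p, hp⟩ = true} = b := by
        funext p
        simp [DSubspace.indicatorAbove, p.2]
      refine ⟨n', hn', {p | ∃ hp : t < p, b ⟨p, hp⟩ = true}, fun p hp hpn => ?_, V, hV, ?_⟩
      · have := hb ⟨p, hp⟩ hpn
        simp only [DSubspace.indicatorAbove] at this
        simp [this, hp]
      · rwa [hind]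
  let D' : ∀ i, Set (T i) := fun i => {x ∈ D i | level x ∈ L}
  have hD' : levelProd D' ⊆ levelProd D := fun t ht i => (ht i).1
  have hLM' : ∀ i, L ⊆ levelSet (D i) := fun i => hD.1 i i₀ ▸ hLM
  have hself' : ∀ p : levelProd D, p.1 ∈ levelProd D' → h p = some p := fun p hp =>
    hself p (hp i₀).2
  refine ⟨D', U.merge hD' h hle hself', DSubspace.isFurther_merge, ⟨fun i j => ?_, fun i => ?_⟩, ?_⟩
  · exact (levelSet_sep (hLM' i)).trans (levelSet_sep (hLM' j)).symm
  · exact (hD.2 i).sep (hT i) (hT' i) (hLM' i) hL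
  · have hcolor : ∀ t : levelProd D, ℓ t ∈ L → ∃ i, ∀ Γ : Set (levelProd D),
        (∀ s ∈ Γ, s.1 ∈ levelProd D' ∧ t ≤ s) → t ∈ Γ →
          c (U.unionAbove t (DSubspace.indicatorAbove t (ownedBy h Γ))) = i := by
      intro t ht
      -- The color `i` is read off from `{t}` alone, before `Γ` is given.
      obtain ⟨hforce, n, ⟨_, ⟨i, rfl⟩, hi⟩, hagree⟩ := hQ t ht
      refine ⟨i, fun Γ hΓ htΓ => hOW t _ (fun j => ?_) i (hi _ fun p hp => ?_)⟩
      · obtain ⟨n, V, hV, hVmem⟩ := hforce (j + 1) Γ (fun s hs => ((hΓ s hs).1 i₀).2) htΓ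
        obtain rfl : V = W t j := hV
        exact hVmem _ fun _ _ => rfl
      · have := hagree Γ (fun s hs => ⟨((hΓ s hs).1 i₀).2, (hΓ s hs).2⟩) htΓ p.1 hp
        simp only [DSubspace.indicatorAbove, this]
    intro V hV V' hV' hmin
    obtain ⟨t, ht, htD, Γ, hΓ, htΓ, rfl⟩ := DSubspace.exists_eq_unionAbove_of_mem_span_merge hV
    obtain ⟨t', ht', -, Γ', hΓ', htΓ', rfl⟩ := DSubspace.exists_eq_unionAbove_of_mem_span_merge hV'
    obtain rfl : t = t' := Subtype.ext (ht.trans (hmin.trans ht'.symm))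
    obtain ⟨i, hi⟩ := hcolor t (htD i₀).2
    rw [hi Γ hΓ htΓ, hi Γ' hΓ' htΓ']
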